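/- Let $\mathcal H$ be a complex Hilbert space, let $n\ge 2$, and put $I_n=\{1,\dots,n\}$. A bounded operator $T$ on $\mathcal H$ is a near-isometry if there is $\delta>0$ with $\delta\|x\|\le\|Tx\|\le\|x\|$ for all $x\in\mathcal H$, and $T^{*m}T^{m+1}\mathcal H\subseteq T\mathcal H$ for all $m\ge 0$. A tuple $(T_1,\dots,T_n)$ of near-isometries on $\mathcal H$ is a doubly twisted near-isometry with respect to commuting unitaries $\{U_{ij}\}_{1\le i<j\le n}$ on $\mathcal H$ if $T_i^*T_j=U_{ij}^*T_jT_i^*$, $T_kU_{ij}=U_{ij}T_k$ and $T_iT_j=U_{ij}T_jT_i$ for all $1\le i<j\le n$ and $1\le k\le n$. An operator $T$ on a Hilbert space $\mathcal K$ is a shift if there is a closed subspace $\mathcal W\subseteq\mathcal K$ with $T^i\mathcal W\perp T^j\mathcal W$ for $i\ne j$ and $\mathcal K=\bigoplus_{m\ge 0}T^m\mathcal W$. A Wold-type decomposition of $(T_1,\dots,T_n)$ is a family $\{\mathcal H_A\}_{A\subseteq I_n}$ of closed subspaces, each reducing every $T_i$, such that $\mathcal H=\bigoplus_{A\subseteq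 I_n}\mathcal H_A$ (orthogonal sum), $T_i|_{\mathcal H_A}$ is a shift if $i\in A$, and $T_i|_{\mathcal H_A}$ is invertible if $i\in I_n\setminus A$. (Zero summands are allowed.) For $A=\{a_1<\dots<a_m\}\subseteq I_n$ and $\boldsymbol k\in\mathbb N_0^{m}$ write $T_A^{\boldsymbol k}=T_{a_1}^{k_1}\cdots T_{a_m}^{k_m}$, and let $\mathcal W_A=\bigcap_{i\in A}\ker T_i^*$, with $\mathcal W_\emptyset=\mathcal H$. Theorem. Every doubly twisted near-isometry $(T_1,\dots,T_n)$ on $\mathcal H$ admits exactly one Wold-type decomposition $\mathcal H=\bigoplus_{A\subseteq I_n}\mathcal H_A$. Its summands are, for every $A\subseteq I_n$, the orthogonal sums of closed subspaces $$\mathcal H_A=\bigoplus_{\boldsymbol k\in\mathbb N_0^{|A|}}T_A^{\boldsymbol k}\Big(\bigcap_{\boldsymbol\ell\in\mathbb N_0^{n-|A|}}T_{I_n\setminus A}^{\boldsymbol\ell}\,\mathcal W_A\Big),$$ and in particular $\mathcal H_\emptyset=\bigcap_{\boldsymbol k\in\mathbb N_0^{n}}T_{I_n}^{\boldsymbol k}\mathcal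 H$. -/

import Mathlib

open ContinuousLinearMap

/-- A bounded operator `T` is a near-isometry if it is a contraction which is bounded below and
`T*ⁿ Tⁿ⁺¹ H ⊆ T H` for every `n ≥ 0`. -/
structure IsNearIsometry {H : Type*} [NormedAddCommGroup H] [InnerProductSpace ℂ H]
    [CompleteSpace H] (T : H →L[ℂ] H) : Prop where
  bounds : ∃ δ : ℝ, 0 < δ ∧ ∀ x : H, δ * ‖x‖ ≤ ‖T x‖ ∧ ‖T x‖ ≤ ‖x‖
  range_subset : ∀ (n : ℕ) (x : H), ∃ y : H, (adjoint T ^ n) ((T ^ (n + 1)) x) = T y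

/-- `T = (T₁, …, Tₙ)` is a doubly twisted near-isometry with respect to the commuting unitaries
`U i j`, `i < j` (the values of `U` at the other pairs of indices play no role). -/
structure IsDoublyTwistedNearIsometry {H : Type*} [NormedAddCommGroup H] [InnerProductSpace ℂ H]
    [CompleteSpace H] {n : ℕ} (T : Fin n → H →L[ℂ] H) (U : Fin n → Fin n → H →L[ℂ] H) :
    Prop where
  nearIsometry : ∀ i, IsNearIsometry (T i)
  unitary : ∀ i j, i < j → U i j ∈ unitary (H →L[ℂ] H)
  commute : ∀ i j k l, i < j → k < l → Commute (U i j) (U k l)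
  adjoint_mul : ∀ i j, i < j → adjoint (T i) * T j = adjoint (U i j) * T j * adjoint (T i)
  mul_twist : ∀ i j k, i < j → T k * U i j = U i j * T k
  mul_mul : ∀ i j, i < j → T i * T j = U i j * T j * T i

/-- `M` is the internal orthogonal (Hilbert space) direct sum of the closed subspaces `V i`. -/
structure IsOrthogonalSum {H : Type*} [NormedAddCommGroup H] [InnerProductSpace ℂ H] {ι : Type*}
    (M : Submodule ℂ H) (V : ι → Submodule ℂ H) : Prop where
  isClosed : ∀ i, IsClosed (V i : Set H)
  orthogonal : ∀ i j, i ≠ j → V i ⟂ V j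
  closure_iSup : (⨆ i, V i).topologicalClosure = M

/-- The image `T W` of a subspace under a bounded operator. -/
def imageUnder {H : Type*} [NormedAddCommGroup H] [InnerProductSpace ℂ H]
    (T : H →L[ℂ] H) (W : Submodule ℂ H) : Submodule ℂ H :=
  W.map (T : H →ₗ[ℂ] H)

/-- A closed subspace `W` is wandering for `T` if `Tⁱ W ⟂ Tʲ W` for `i ≠ j`. -/
def IsWandering {H : Type*} [NormedAddCommGroup H] [InnerProductSpace ℂ H]
    (T : H →L[ℂ] H) (W : Submodule ℂ H) : Prop :=
  IsClosed (W : Set H) ∧ ∀ i j : ℕ, i ≠ j → imageUnder (T ^ i) W ⟂ imageUnder (T ^ j) W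

/-- `T` is a shift if the whole space is `⨁ₖ Tᵏ W` for some wandering subspace `W`. -/
def IsShift {H : Type*} [NormedAddCommGroup H] [InnerProductSpace ℂ H] (T : H →L[ℂ] H) : Prop :=
  ∃ W : Submodule ℂ H, IsWandering T W ∧
    IsOrthogonalSum ⊤ (fun k : ℕ => imageUnder (T ^ k) W)

/-- `M` reduces `T`: it is invariant under both `T` and `T*`. -/
structure Reduces {H : Type*} [NormedAddCommGroup H] [InnerProductSpace ℂ H] [CompleteSpace H]
    (M : Submodule ℂ H) (T : H →L[ℂ] H) : Prop where
  map_mem : ∀ x ∈ M, T x ∈ M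
  adjoint_map_mem : ∀ x ∈ M, adjoint T x ∈ M

/-- The restriction `T|_M : M → M` of `T` to a reducing subspace `M`. -/
noncomputable def Reduces.restriction {H : Type*} [NormedAddCommGroup H] [InnerProductSpace ℂ H]
    [CompleteSpace H] {M : Submodule ℂ H} {T : H →L[ℂ] H} (h : Reduces M T) : M →L[ℂ] M :=
  T.restrict h.map_mem

/-- The family `(𝓗 A)`, `A ⊆ {1, …, n}`, of closed subspaces is a Wold-type decomposition of the
space for the tuple `T`. (Closedness of each `𝓗 A` is part of `IsOrthogonalSum`.) -/
structure IsWoldDecomposition {H : Type*} [NormedAddCommGroup H] [InnerProductSpace ℂ H]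
    [CompleteSpace H] {n : ℕ} (T : Fin n → H →L[ℂ] H) (𝓗 : Finset (Fin n) → Submodule ℂ H) :
    Prop where
  orthogonalSum : IsOrthogonalSum ⊤ 𝓗
  reduces : ∀ A i, Reduces (𝓗 A) (T i)
  shift : ∀ A i, i ∈ A → IsShift (reduces A i).restriction
  invertible : ∀ A i, i ∉ A → IsUnit (reduces A i).restriction

/-- `T_A^k = T_{a₁}^{k₁} ⋯ T_{aₘ}^{kₘ}` for `A = {a₁ < ⋯ < aₘ}`: the product over all indices in
increasing order, with the identity in the places outside `A`. -/
noncomputable def tuplePow {H : Type*} [NormedAddCommGroup H] [InnerProductSpace ℂ H] {n : ℕ}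
    (T : Fin n → H →L[ℂ] H) (A : Finset (Fin n)) (k : A → ℕ) : H →L[ℂ] H :=
  (List.ofFn fun i : Fin n => if h : i ∈ A then T i ^ k ⟨i, h⟩ else 1).prod

/-- `W_A = ⋂_{i ∈ A} ker T_i*`, the whole space when `A` is empty. -/
noncomputable def wanderingSpace {H : Type*} [NormedAddCommGroup H] [InnerProductSpace ℂ H]
    [CompleteSpace H] {n : ℕ} (T : Fin n → H →L[ℂ] H) (A : Finset (Fin n)) : Submodule ℂ H :=
  ⨅ i ∈ A, LinearMap.ker (adjoint (T i) : H →ₗ[ℂ] H)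

/-- `⋂_ℓ T_{Aᶜ}^ℓ W_A`, where `ℓ` runs over the multi-indices indexed by the complement of `A`. -/
noncomputable def wanderingCore {H : Type*} [NormedAddCommGroup H] [InnerProductSpace ℂ H]
    [CompleteSpace H] {n : ℕ} (T : Fin n → H →L[ℂ] H) (A : Finset (Fin n)) : Submodule ℂ H :=
  ⨅ l : ↥(Aᶜ : Finset (Fin n)) → ℕ, imageUnder (tuplePow T Aᶜ l) (wanderingSpace T A)

/-!
For one operator `T`, the ranges `ran Tᵏ` decrease, so the orthocomplement of the core
`⋂ₖ ran Tᵏ` is the closed span of the layers `ran Tᵏ ⊖ ran Tᵏ⁺¹`. The condition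
`T*ⁿ Tⁿ⁺¹ H ⊆ T H` says that `Tᵏ (ker T*) ⟂ ran Tᵏ⁺¹`, which identifies the `k`-th layer with
`Tᵏ (ker T*)`; hence the core reduces `T`, which is invertible on it and a shift on its
orthocomplement.

The twisting enters only through one consequence: `ran Tᵢᵏ` reduces `Tⱼ` for `i ≠ j`. Projections
onto the layers and cores of different operators therefore commute, and the decompositions
belonging to the individual operators have a common refinement. Its pieces, the intersections of
the cores of `Tᵢ` for `i ∉ A` with the orthocomplements of the cores for `i ∈ A`, form a Wold-type
decomposition. It is the only one: an invertible restriction forces a summand into the core, a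
shift forces it into the orthocomplement of the core, and an orthogonal sum filling `H` whose
summands lie in pairwise orthogonal subspaces must exhaust these.
-/

section Subspaces

theorem isClosed_coe_iInf {R M : Type*} [Semiring R] [AddCommMonoid M] [Module R M]
    [TopologicalSpace M] {ι : Sort*} {V : ι → Submodule R M} (h : ∀ i, IsClosed (V i : Set M)) :
    IsClosed ((⨅ i, V i : Submodule R M) : Set M) := by
  rw [Submodule.coe_iInf]
  exact isClosed_iInter h

theorem inf_orthogonal_inf_orthogonal_le {𝕜 E : Type*} [RCLike 𝕜] [NormedAddCommGroup E]
    [InnerProductSpace 𝕜 E] {K M : Submodule 𝕜 E} [K.HasOrthogonalProjection] (h : K ≤ M) :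
    M ⊓ (M ⊓ Kᗮ)ᗮ ≤ K := by
  rintro x ⟨hxM, hx⟩
  rw [← K.starProjection_eq_self_iff, ← sub_eq_zero, ← neg_eq_zero, neg_sub]
  set d := x - K.starProjection x
  have hdK : d ∈ Kᗮ := Submodule.sub_starProjection_mem_orthogonal x
  have hdM : d ∈ M := sub_mem hxM (h (Submodule.starProjection_apply_mem K x))
  have hdx : inner 𝕜 d x = 0 := hx d ⟨hdM, hdK⟩
  have hdp : inner 𝕜 d (K.starProjection x) = 0 :=
    Submodule.inner_left_of_mem_orthogonal (Submodule.starProjection_apply_mem K x) hdK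
  rw [← inner_self_eq_zero (𝕜 := 𝕜), inner_sub_right, hdx, hdp, sub_zero]

theorem orthogonal_iInf_le_closure_iSup_of_antitone {𝕜 E : Type*} [RCLike 𝕜]
    [NormedAddCommGroup E] [InnerProductSpace 𝕜 E] [CompleteSpace E] {R : ℕ → Submodule 𝕜 E}
    [∀ k, (R k).HasOrthogonalProjection] (hR : Antitone R) (h0 : R 0 = ⊤) :
    (⨅ k, R k)ᗮ ≤ (⨆ k, R k ⊓ (R (k + 1))ᗮ).topologicalClosure := by
  rw [← Submodule.orthogonal_orthogonal_eq_closure]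
  refine Submodule.orthogonal_le (le_iInf fun k => ?_)
  induction k with
  | zero => exact h0 ▸ le_top
  | succ k ih =>
    exact (le_inf ih (Submodule.orthogonal_le (le_iSup (fun k => R k ⊓ (R (k + 1))ᗮ) k))).trans
      (inf_orthogonal_inf_orthogonal_le (hR k.le_succ))

end Subspaces

section OrthogonalSums

variable {H : Type*} [NormedAddCommGroup H] [InnerProductSpace ℂ H]

theorem IsOrthogonalSum.eq_of_le [CompleteSpace H] {ι : Type*} {V W : ι → Submodule ℂ H}
    (hV : IsOrthogonalSum ⊤ V) (hW : ∀ i j, i ≠ j → W i ⟂ W j) (hle : ∀ i, V i ≤ W i) :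
    V = W := by
  funext i
  have : CompleteSpace (V i) := (hV.isClosed i).completeSpace_coe
  have hsum : (⨆ j, V j)ᗮ = ⊥ := Submodule.topologicalClosure_eq_top_iff.1 hV.closure_iSup
  have hbot : (V i)ᗮ ⊓ W i = ⊥ := by
    rw [eq_bot_iff, ← hsum, ← Submodule.iInf_orthogonal]
    refine le_iInf fun j => ?_
    obtain rfl | hij := eq_or_ne i j
    · exact inf_le_left
    · exact inf_le_right.trans ((hW i j hij).mono_right (hle j)).le
  calc V i = V i ⊔ (V i)ᗮ ⊓ W i := by rw [hbot, sup_bot_eq]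
    _ = W i := Submodule.sup_orthogonal_inf_of_hasOrthogonalProjection (hle i)

theorem IsOrthogonalSum.comap_subtype {ι : Type*} {N : Submodule ℂ H} {V : ι → Submodule ℂ H}
    (h : IsOrthogonalSum N V) :
    IsOrthogonalSum (⊤ : Submodule ℂ N) (fun i => (V i).comap N.subtype) where
  isClosed i := (h.isClosed i).preimage continuous_subtype_val
  orthogonal i j hij := (h.orthogonal i j hij).comap N.subtypeₗᵢ
  closure_iSup := by
    have hVN : ∀ i, V i ≤ N := fun i =>
      ((le_iSup V i).trans (Submodule.le_topologicalClosure _)).trans h.closure_iSup.le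
    have hmap : (⨆ i, (V i).comap N.subtype).map N.subtype = ⨆ i, V i := by
      simp only [Submodule.map_iSup, Submodule.map_comap_subtype, inf_eq_right.2 (hVN _)]
    refine eq_top_iff.2 fun x _ => ?_
    have hx : (x : H) ∈ (⨆ i, V i).topologicalClosure := h.closure_iSup.ge x.2
    rw [← hmap] at hx
    have hclosure : x ∈ closure ((⨆ i, (V i).comap N.subtype : Submodule ℂ N) : Set N) :=
      closure_subtype.2 hx
    exact hclosure

end OrthogonalSums

section Reducing

variable {H : Type*} [NormedAddCommGroup H] [InnerProductSpace ℂ H] [CompleteSpace H]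
  {M N : Submodule ℂ H} {S T : H →L[ℂ] H}

theorem reduces_top : Reduces ⊤ T := ⟨fun _ _ => trivial, fun _ _ => trivial⟩

theorem reduces_one : Reduces M 1 := by
  refine ⟨fun _ hx => hx, fun x hx => ?_⟩
  rwa [← star_eq_adjoint, star_one]

theorem Reduces.mul (hS : Reduces M S) (hT : Reduces M T) : Reduces M (S * T) := by
  refine ⟨fun x hx => hS.map_mem _ (hT.map_mem x hx), fun x hx => ?_⟩
  rw [← star_eq_adjoint, star_mul]
  exact hT.adjoint_map_mem _ (hS.adjoint_map_mem x hx)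

theorem Reduces.pow (h : Reduces M T) (k : ℕ) : Reduces M (T ^ k) := by
  induction k with
  | zero => exact reduces_one
  | succ k ih => exact pow_succ T k ▸ ih.mul h

theorem Reduces.orthogonal (h : Reduces M T) : Reduces Mᗮ T where
  map_mem x hx u hu := by
    rw [← adjoint_inner_left]
    exact hx _ (h.adjoint_map_mem u hu)
  adjoint_map_mem x hx u hu := by
    rw [adjoint_inner_right]
    exact hx _ (h.map_mem u hu)

theorem Reduces.inf (hM : Reduces M T) (hN : Reduces N T) : Reduces (M ⊓ N) T where
  map_mem x hx := ⟨hM.map_mem x hx.1, hN.map_mem x hx.2⟩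
  adjoint_map_mem x hx := ⟨hM.adjoint_map_mem x hx.1, hN.adjoint_map_mem x hx.2⟩

theorem Reduces.iInf {ι : Sort*} {V : ι → Submodule ℂ H} (h : ∀ i, Reduces (V i) T) :
    Reduces (⨅ i, V i) T := by
  constructor <;> simp only [Submodule.mem_iInf] <;> intro x hx i
  · exact (h i).map_mem x (hx i)
  · exact (h i).adjoint_map_mem x (hx i)

theorem Reduces.starProjection_apply [M.HasOrthogonalProjection] (h : Reduces M T) (x : H) :
    M.starProjection (T x) = T (M.starProjection x) := by
  refine Submodule.eq_starProjection_of_mem_orthogonal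
    (h.map_mem _ (Submodule.starProjection_apply_mem M x)) ?_
  rw [← map_sub]
  exact h.orthogonal.map_mem _ (Submodule.sub_starProjection_mem_orthogonal x)

theorem Reduces.imageUnder_inf (h : Reduces N T) (hN : IsClosed (N : Set H))
    (hT : Function.Injective T) (W : Submodule ℂ H) :
    imageUnder T (N ⊓ W) = N ⊓ imageUnder T W := by
  refine le_antisymm ?_ ?_
  · rintro _ ⟨x, ⟨hxN, hxW⟩, rfl⟩
    exact ⟨h.map_mem x hxN, x, hxW, rfl⟩
  · rintro _ ⟨hxN, x, hxW, rfl⟩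
    have : CompleteSpace N := hN.completeSpace_coe
    have hfix : T (N.starProjection x) = T x := by
      rw [← h.starProjection_apply]
      exact Submodule.starProjection_eq_self_iff.2 hxN
    exact ⟨x, ⟨Submodule.starProjection_eq_self_iff.1 (hT hfix), hxW⟩, rfl⟩

theorem Reduces.coe_restriction_pow (h : Reduces M T) (k : ℕ) (x : M) :
    ((h.restriction ^ k) x : H) = (T ^ k) x := by
  induction k generalizing x with
  | zero => rfl
  | succ k ih => 
    rw [pow_succ, pow_succ, mul_apply_eq_comp, ih]
    rfl

theorem Reduces.imageUnder_restriction_pow (h : Reduces M T) (k : ℕ) (W : Submodule ℂ H) :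
    imageUnder (h.restriction ^ k) (W.comap M.subtype) =
      (imageUnder (T ^ k) (M ⊓ W)).comap M.subtype := by
  ext x
  constructor
  · rintro ⟨y, hy, rfl⟩
    exact ⟨y, ⟨y.2, hy⟩, (h.coe_restriction_pow k y).symm⟩
  · rintro ⟨y, ⟨hyM, hyW⟩, hyx⟩
    exact ⟨⟨y, hyM⟩, hyW, Subtype.ext ((h.coe_restriction_pow k _).trans hyx)⟩

theorem reduces_starProjection [N.HasOrthogonalProjection]
    (h : ∀ x ∈ M, N.starProjection x ∈ M) : Reduces M N.starProjection where
  map_mem := h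
  adjoint_map_mem := by rwa [← star_eq_adjoint, (isSelfAdjoint_starProjection N).star_eq]

theorem Reduces.starProjection_symm [M.HasOrthogonalProjection] [N.HasOrthogonalProjection]
    (h : Reduces M N.starProjection) : Reduces N M.starProjection := by
  refine reduces_starProjection fun x hx => ?_
  rw [← Submodule.starProjection_eq_self_iff.2 hx, h.starProjection_apply]
  exact Submodule.starProjection_apply_mem N _

theorem le_closure_iSup_inf {κ : Type*} {V : κ → Submodule ℂ H} [N.HasOrthogonalProjection]
    (hspan : N ≤ (⨆ k, V k).topologicalClosure) (hV : ∀ k, Reduces (V k) N.starProjection) :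
    N ≤ (⨆ k, N ⊓ V k).topologicalClosure := by
  have hcomap : (⨆ k, V k).topologicalClosure ≤
      (⨆ k, N ⊓ V k).topologicalClosure.comap (N.starProjection : H →ₗ[ℂ] H) := by
    refine Submodule.topologicalClosure_minimal _ (iSup_le fun k x hx => ?_)
      ((Submodule.isClosed_topologicalClosure _).preimage N.starProjection.continuous)
    exact Submodule.le_topologicalClosure _ (Submodule.mem_iSup_of_mem k
      ⟨Submodule.starProjection_apply_mem N x, (hV k).map_mem x hx⟩)
  intro x hx
  rw [← Submodule.starProjection_eq_self_iff.2 hx]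
  exact hcomap (hspan hx)

theorem le_closure_iSup_inf_iInf {ι κ : Type*} [Finite ι] [Nonempty κ] {V : ι → κ → Submodule ℂ H}
    [∀ i k, (V i k).HasOrthogonalProjection] (hN : IsClosed (N : Set H))
    (hspan : ∀ i, N ≤ (⨆ k, V i k).topologicalClosure)
    (hNV : ∀ i k, Reduces N (V i k).starProjection)
    (hVV : ∀ i j, i ≠ j → ∀ k l, Reduces (V i k) (V j l).starProjection) :
    N ≤ (⨆ c : ι → κ, N ⊓ ⨅ i, V i (c i)).topologicalClosure := by
  classical
  have := Fintype.ofFinite ι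
  suffices h : ∀ s : Finset ι, N ≤ (⨆ c : ι → κ, N ⊓ ⨅ i ∈ s, V i (c i)).topologicalClosure by
    simpa only [Finset.mem_univ, iInf_pos] using h Finset.univ
  intro s
  induction s using Finset.induction_on with
  | empty =>
    simp only [Finset.notMem_empty, iInf_false, iInf_top, inf_top_eq, iSup_const]
    exact N.le_topologicalClosure
  | insert j s hj ih =>
    refine ih.trans (Submodule.topologicalClosure_minimal _ (iSup_le fun c => ?_)
      (Submodule.isClosed_topologicalClosure _))
    have hVc : ∀ i k, IsClosed (V i k : Set H) := fun i k =>
      (V i k).orthogonal_orthogonal ▸ (V i k)ᗮ.isClosed_orthogonal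
    have hclosed : IsClosed ((N ⊓ ⨅ i ∈ s, V i (c i) : Submodule ℂ H) : Set H) :=
      hN.inter (isClosed_coe_iInf fun i => isClosed_coe_iInf fun _ => hVc i (c i))
    have : CompleteSpace (N ⊓ ⨅ i ∈ s, V i (c i) : Submodule ℂ H) := hclosed.completeSpace_coe
    have hred : ∀ k, Reduces (N ⊓ ⨅ i ∈ s, V i (c i)) (V j k).starProjection := fun k =>
      (hNV j k).inf (Reduces.iInf fun i => Reduces.iInf fun hi =>
        hVV i j (ne_of_mem_of_not_mem hi hj) _ k)
    refine (le_closure_iSup_inf (inf_le_left.trans (hspan j))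
      fun k => (hred k).starProjection_symm).trans
      (Submodule.topologicalClosure_mono (iSup_le fun k => ?_))
    refine le_iSup_of_le (Function.update c j k) ?_
    have hupdate : ⨅ i ∈ s, V i (Function.update c j k i) = ⨅ i ∈ s, V i (c i) :=
      biInf_congr fun i hi => by rw [Function.update_of_ne (ne_of_mem_of_not_mem hi hj)]
    rw [Finset.iInf_insert, hupdate, Function.update_self, inf_assoc,
      inf_comm (V j k)]

end Reducing

section Powers

variable {H : Type*} [NormedAddCommGroup H] [InnerProductSpace ℂ H] {N : Submodule ℂ H}
  {S T : H →L[ℂ] H}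

theorem imageUnder_one (W : Submodule ℂ H) : imageUnder (1 : H →L[ℂ] H) W = W :=
  Submodule.map_id W

theorem imageUnder_mul (S T : H →L[ℂ] H) (W : Submodule ℂ H) :
    imageUnder (S * T) W = imageUnder S (imageUnder T W) :=
  Submodule.map_comp _ _ W

/-- The range of `T ^ k`. -/
noncomputable def powRange (T : H →L[ℂ] H) (k : ℕ) : Submodule ℂ H :=
  imageUnder (T ^ k) ⊤

/-- The `k`-th layer `ran Tᵏ ⊖ ran Tᵏ⁺¹`, the candidate for the summand `Tᵏ (ker T*)`. -/
noncomputable def powLayer (T : H →L[ℂ] H) (k : ℕ) : Submodule ℂ H :=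
  powRange T k ⊓ (powRange T (k + 1))ᗮ

/-- The core `⋂ₖ ran Tᵏ`, the candidate for the part of the space on which `T` is invertible. -/
noncomputable def powCore (T : H →L[ℂ] H) : Submodule ℂ H :=
  ⨅ k, powRange T k

theorem powRange_zero (T : H →L[ℂ] H) : powRange T 0 = ⊤ :=
  imageUnder_one ⊤

theorem powRange_add (T : H →L[ℂ] H) (k l : ℕ) :
    powRange T (k + l) = imageUnder (T ^ k) (powRange T l) := by
  rw [powRange, powRange, pow_add, imageUnder_mul]

theorem antitone_powRange (T : H →L[ℂ] H) : Antitone (powRange T) :=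
  antitone_nat_of_succ_le fun k => powRange_add T k 1 ▸ Submodule.map_mono le_top

theorem powLayer_isOrtho (T : H →L[ℂ] H) {k l : ℕ} (h : k ≠ l) : powLayer T k ⟂ powLayer T l := by
  wlog hkl : k < l generalizing k l
  · exact (this h.symm (h.lt_or_gt.resolve_left hkl)).symm
  · exact inf_le_right.trans
      (Submodule.orthogonal_le (inf_le_left.trans (antitone_powRange T hkl)))

theorem powLayer_le_orthogonal_powCore (T : H →L[ℂ] H) (k : ℕ) :
    powLayer T k ≤ (powCore T)ᗮ :=
  inf_le_right.trans (Submodule.orthogonal_le (iInf_le _ (k + 1)))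

theorem powLayer_zero (T : H →L[ℂ] H) : powLayer T 0 = (powRange T 1)ᗮ := by
  rw [powLayer, powRange_zero, top_inf_eq]

theorem IsShift.powCore_eq_bot (h : IsShift S) : powCore S = ⊥ := by
  obtain ⟨W, hW, hsum⟩ := h
  have hrange : ∀ k, powRange S (k + 1) ≤ (imageUnder (S ^ k) W)ᗮ := fun k => by
    have hcomap : (⨆ l, imageUnder (S ^ l) W).topologicalClosure ≤
        (imageUnder (S ^ k) W)ᗮ.comap ((S ^ (k + 1) : H →L[ℂ] H) : H →ₗ[ℂ] H) := by
      refine Submodule.topologicalClosure_minimal _ (iSup_le fun l => ?_)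
        ((Submodule.isClosed_orthogonal _).preimage (S ^ (k + 1)).continuous)
      refine Submodule.map_le_iff_le_comap.1 (le_of_eq_of_le ?_ (hW.2 (k + 1 + l) k (by lia)))
      rw [pow_add S (k + 1) l, imageUnder_mul]
      rfl
    exact Submodule.map_le_iff_le_comap.2 (hsum.closure_iSup ▸ hcomap)
  rw [← Submodule.orthogonal_eq_top_iff, eq_top_iff, ← hsum.closure_iSup]
  refine Submodule.topologicalClosure_minimal _ (iSup_le fun k => ?_)
    (Submodule.isClosed_orthogonal _)
  exact (Submodule.isOrtho_iff_le.2 ((iInf_le _ (k + 1)).trans (hrange k))).symm.le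

variable [CompleteSpace H]

theorem powLayer_zero_eq_ker_adjoint (T : H →L[ℂ] H) :
    powLayer T 0 = LinearMap.ker (adjoint T : H →ₗ[ℂ] H) := by
  rw [powLayer_zero, powRange, pow_one, imageUnder, Submodule.map_top]
  exact T.orthogonal_range

theorem Reduces.powRange_starProjection [N.HasOrthogonalProjection] (h : Reduces N T) (k : ℕ) :
    Reduces (powRange T k) N.starProjection := by
  refine reduces_starProjection ?_
  rintro _ ⟨y, -, rfl⟩
  exact ⟨N.starProjection y, trivial, ((h.pow k).starProjection_apply y).symm⟩

theorem Reduces.powLayer_starProjection [N.HasOrthogonalProjection] (h : Reduces N T) (k : ℕ) :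
    Reduces (powLayer T k) N.starProjection :=
  (h.powRange_starProjection k).inf (h.powRange_starProjection (k + 1)).orthogonal

theorem Reduces.powCore_starProjection [N.HasOrthogonalProjection] (h : Reduces N T) :
    Reduces (powCore T) N.starProjection :=
  Reduces.iInf h.powRange_starProjection

theorem Reduces.le_powCore_of_isUnit (h : Reduces N T) (hu : IsUnit h.restriction) :
    N ≤ powCore T := by
  refine le_iInf fun k x hx => ?_
  obtain ⟨R, hR⟩ := (hu.pow k).exists_right_inv
  refine ⟨R ⟨x, hx⟩, trivial, (h.coe_restriction_pow k _).symm.trans ?_⟩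
  rw [← mul_apply_eq_comp, hR]
  rfl

theorem Reduces.le_orthogonal_powCore_of_isShift (h : Reduces N T) (hN : IsClosed (N : Set H))
    (hs : IsShift h.restriction) : N ≤ (powCore T)ᗮ := by
  have : CompleteSpace N := hN.completeSpace_coe
  suffices hort : powCore T ≤ Nᗮ from (Submodule.isOrtho_iff_le.2 hort).symm.le
  intro x hx
  have hproj : N.orthogonalProjectionOnto x ∈ powCore h.restriction := by
    refine (Submodule.mem_iInf _).2 fun k => ?_
    obtain ⟨y, -, rfl⟩ := (Submodule.mem_iInf _).1 hx k
    refine ⟨N.orthogonalProjectionOnto y, trivial, Subtype.ext ?_⟩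
    exact (h.coe_restriction_pow k _).trans ((h.pow k).starProjection_apply y).symm
  rw [hs.powCore_eq_bot, Submodule.mem_bot] at hproj
  rwa [← Submodule.orthogonalProjectionOnto_eq_zero_iff]

end Powers

section NearIsometry

variable {H : Type*} [NormedAddCommGroup H] [InnerProductSpace ℂ H] [CompleteSpace H]
  {N : Submodule ℂ H} {T : H →L[ℂ] H}

/-- A near-isometry up to a scalar factor: `T` is bounded below and `T*ⁿ Tⁿ⁺¹ H ⊆ T H` for every
`n ≥ 0`, both of which are invariant under multiplying `T` by a nonzero scalar. -/
structure IsScaledNearIsometry (T : H →L[ℂ] H) : Prop where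
  antilipschitz : ∃ K : NNReal, AntilipschitzWith K T
  range_subset : ∀ (n : ℕ) (x : H), ∃ y : H, (adjoint T ^ n) ((T ^ (n + 1)) x) = T y

theorem IsNearIsometry.isScaledNearIsometry (hT : IsNearIsometry T) : IsScaledNearIsometry T where
  antilipschitz := by
    obtain ⟨δ, hδ, h⟩ := hT.bounds
    refine ⟨⟨δ⁻¹, (inv_pos.2 hδ).le⟩, T.antilipschitz_of_bound fun x => ?_⟩
    change ‖x‖ ≤ δ⁻¹ * ‖T x‖
    rw [inv_mul_eq_div, le_div_iff₀ hδ, mul_comm]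
    exact (h x).1
  range_subset := hT.range_subset

namespace IsScaledNearIsometry

theorem antilipschitz_pow (hT : IsScaledNearIsometry T) (k : ℕ) :
    ∃ K : NNReal, AntilipschitzWith K (T ^ k) := by
  induction k with
  | zero => exact ⟨1, AntilipschitzWith.id⟩
  | succ k ih =>
    obtain ⟨K, hK⟩ := hT.antilipschitz
    obtain ⟨L, hL⟩ := ih
    exact ⟨K * L, pow_succ T k ▸ hL.comp hK⟩

theorem injective_pow (hT : IsScaledNearIsometry T) (k : ℕ) : Function.Injective (T ^ k) := by
  obtain ⟨K, hK⟩ := hT.antilipschitz_pow k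
  exact hK.injective

theorem isClosed_powRange (hT : IsScaledNearIsometry T) (k : ℕ) :
    IsClosed (powRange T k : Set H) := by
  obtain ⟨K, hK⟩ := hT.antilipschitz_pow k
  exact (hK.isClosedEmbedding (T ^ k).uniformContinuous).isClosedMap _ isClosed_univ

theorem isClosed_powLayer (hT : IsScaledNearIsometry T) (k : ℕ) :
    IsClosed (powLayer T k : Set H) :=
  (hT.isClosed_powRange k).inter (Submodule.isClosed_orthogonal _)

theorem isClosed_powCore (hT : IsScaledNearIsometry T) : IsClosed (powCore T : Set H) :=
  isClosed_coe_iInf hT.isClosed_powRange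

theorem imageUnder_powLayer_zero_le_orthogonal (hT : IsScaledNearIsometry T) (k : ℕ) :
    imageUnder (T ^ k) (powLayer T 0) ≤ (powRange T (k + 1))ᗮ := by
  rintro _ ⟨w, hw, rfl⟩ _ ⟨y, -, rfl⟩
  obtain ⟨z, hz⟩ := hT.range_subset k y
  have hadj : adjoint (T ^ k) ((T ^ (k + 1)) y) = T z := by
    rw [← hz, ← star_eq_adjoint, star_pow, star_eq_adjoint]
  have hw' : adjoint T w = 0 := (powLayer_zero_eq_ker_adjoint T).le hw
  calc inner ℂ ((T ^ (k + 1)) y) ((T ^ k) w) = inner ℂ (T z) w := by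
        rw [← adjoint_inner_left, hadj]
    _ = 0 := by rw [← adjoint_inner_right, hw', inner_zero_right]

theorem imageUnder_pow_powLayer_zero (hT : IsScaledNearIsometry T) (k : ℕ) :
    imageUnder (T ^ k) (powLayer T 0) = powLayer T k := by
  have : CompleteSpace (powRange T 1) := (hT.isClosed_powRange 1).completeSpace_coe
  have hsplit : powRange T k = imageUnder (T ^ k) (powLayer T 0) ⊔ powRange T (k + 1) := by
    rw [powRange_add, powLayer_zero, imageUnder, imageUnder, ← Submodule.map_sup, sup_comm,
      Submodule.sup_orthogonal_of_hasOrthogonalProjection]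
    rfl
  rw [powLayer.eq_def T k, hsplit,
    sup_inf_assoc_of_le _ (hT.imageUnder_powLayer_zero_le_orthogonal k),
    Submodule.inf_orthogonal_eq_bot, sup_bot_eq]

theorem imageUnder_powLayer (hT : IsScaledNearIsometry T) (k : ℕ) :
    imageUnder T (powLayer T k) = powLayer T (k + 1) := by
  rw [← hT.imageUnder_pow_powLayer_zero k, ← imageUnder_mul, ← pow_succ',
    hT.imageUnder_pow_powLayer_zero]

theorem orthogonal_powCore_le (hT : IsScaledNearIsometry T) :
    (powCore T)ᗮ ≤ (⨆ k, powLayer T k).topologicalClosure := by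
  have (k : ℕ) : CompleteSpace (powRange T k) := (hT.isClosed_powRange k).completeSpace_coe
  exact orthogonal_iInf_le_closure_iSup_of_antitone (antitone_powRange T) (powRange_zero T)

theorem reduces_powCore (hT : IsScaledNearIsometry T) : Reduces (powCore T) T := by
  have : CompleteSpace (powCore T) := hT.isClosed_powCore.completeSpace_coe
  have hcore : imageUnder T (powCore T) ≤ powCore T := le_iInf fun k => by
    refine le_trans ?_ (antitone_powRange T k.le_succ)
    rw [Nat.succ_eq_one_add, powRange_add, pow_one]
    exact Submodule.map_mono (iInf_le _ k)
  have horth : (powCore T)ᗮ ≤ (powCore T)ᗮ.comap (T : H →ₗ[ℂ] H) := by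
    refine hT.orthogonal_powCore_le.trans (Submodule.topologicalClosure_minimal _
      (iSup_le fun k => ?_) ((Submodule.isClosed_orthogonal _).preimage T.continuous))
    exact Submodule.map_le_iff_le_comap.1
      ((hT.imageUnder_powLayer k).trans_le (powLayer_le_orthogonal_powCore T (k + 1)))
  refine ⟨fun x hx => hcore ⟨x, hx, rfl⟩, fun x hx => ?_⟩
  rw [← Submodule.orthogonal_orthogonal (powCore T)]
  intro u hu
  rw [adjoint_inner_right]
  exact Submodule.inner_left_of_mem_orthogonal hx (horth hu)

end IsScaledNearIsometry

theorem Reduces.imageUnder_pow_inf_powLayer_zero (h : Reduces N T) (hT : IsScaledNearIsometry T)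
    (hN : IsClosed (N : Set H)) (k : ℕ) :
    imageUnder (T ^ k) (N ⊓ powLayer T 0) = N ⊓ powLayer T k := by
  rw [(h.pow k).imageUnder_inf hN (hT.injective_pow k), hT.imageUnder_pow_powLayer_zero]

theorem Reduces.isUnit_restriction (h : Reduces N T) (hT : IsScaledNearIsometry T)
    (hN : IsClosed (N : Set H)) (hle : N ≤ powCore T) : IsUnit h.restriction := by
  have : CompleteSpace N := hN.completeSpace_coe
  have hinj : Function.Injective T := pow_one T ▸ hT.injective_pow 1
  have honto : imageUnder T N = N := by
    have hrange : N ≤ imageUnder T ⊤ := pow_one T ▸ hle.trans (iInf_le _ 1)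
    rw [← inf_top_eq N, h.imageUnder_inf hN hinj, inf_top_eq, inf_eq_left.2 hrange]
  refine isUnit_iff_bijective.2 ⟨fun x y hxy => ?_, fun x => ?_⟩
  · exact Subtype.ext (hinj (congrArg Subtype.val hxy))
  · obtain ⟨y, hy, hyx⟩ := honto.ge x.2
    exact ⟨⟨y, hy⟩, Subtype.ext hyx⟩

theorem Reduces.isOrthogonalSum_inf_powLayer (h : Reduces N T) (hT : IsScaledNearIsometry T)
    (hN : IsClosed (N : Set H)) (hle : N ≤ (powCore T)ᗮ) :
    IsOrthogonalSum N (fun k => N ⊓ powLayer T k) where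
  isClosed k := hN.inter (hT.isClosed_powLayer k)
  orthogonal _ _ hkl := (powLayer_isOrtho T hkl).mono inf_le_right inf_le_right
  closure_iSup := by
    have : CompleteSpace N := hN.completeSpace_coe
    exact le_antisymm
      (Submodule.topologicalClosure_minimal _ (iSup_le fun _ => inf_le_left) hN)
      (le_closure_iSup_inf (hle.trans hT.orthogonal_powCore_le) h.powLayer_starProjection)

theorem Reduces.isShift_restriction (h : Reduces N T) (hT : IsScaledNearIsometry T)
    (hN : IsClosed (N : Set H)) (hle : N ≤ (powCore T)ᗮ) : IsShift h.restriction := by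
  have hsum : IsOrthogonalSum ⊤
      fun k => imageUnder (h.restriction ^ k) ((powLayer T 0).comap N.subtype) := by
    simp only [h.imageUnder_restriction_pow, h.imageUnder_pow_inf_powLayer_zero hT hN]
    exact (h.isOrthogonalSum_inf_powLayer hT hN hle).comap_subtype
  exact ⟨_, ⟨(hT.isClosed_powLayer 0).preimage continuous_subtype_val, hsum.orthogonal⟩, hsum⟩

end NearIsometry

section Twist

theorem mul_pow_of_mul_twist {M : Type*} [Monoid M] {s t v : M} (h : s * t = t * (s * v))
    (hv : Commute t v) (k : ℕ) : s * t ^ k = t ^ k * (s * v ^ k) := by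
  induction k with
  | zero => simp only [pow_zero, mul_one, one_mul]
  | succ k ih =>
    calc s * t ^ (k + 1) = t ^ k * (s * (v ^ k * t)) := by
          rw [pow_succ, ← mul_assoc, ih, mul_assoc, mul_assoc]
      _ = t ^ k * (s * t * v ^ k) := by rw [← (hv.pow_right k).eq, mul_assoc]
      _ = t ^ (k + 1) * (s * v ^ (k + 1)) := by
          rw [h, pow_succ, pow_succ']
          simp only [mul_assoc]

theorem commute_star_of_mem_unitary {R : Type*} [Monoid R] [StarMul R] {a u : R}
    (hu : u ∈ unitary R) (h : Commute a u) : Commute a (star u) :=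
  Commute.units_inv_right (u := Unitary.toUnits ⟨u, hu⟩) h

variable {H : Type*} [NormedAddCommGroup H] [InnerProductSpace ℂ H] [CompleteSpace H]

theorem reduces_powRange_of_mul_twist {S T V W : H →L[ℂ] H} (h : S * T = T * (S * V))
    (hV : Commute T V) (h' : adjoint S * T = T * (adjoint S * W)) (hW : Commute T W) (k : ℕ) :
    Reduces (powRange T k) S := by
  constructor <;> rintro _ ⟨y, -, rfl⟩
  · exact ⟨(S * V ^ k) y, trivial, DFunLike.congr_fun (mul_pow_of_mul_twist h hV k).symm y⟩
  · exact ⟨(adjoint S * W ^ k) y, trivial,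
      DFunLike.congr_fun (mul_pow_of_mul_twist h' hW k).symm y⟩

variable {n : ℕ} {T : Fin n → H →L[ℂ] H} {U : Fin n → Fin n → H →L[ℂ] H}

theorem IsDoublyTwistedNearIsometry.exists_twist (hT : IsDoublyTwistedNearIsometry T U)
    {i j : Fin n} (hij : i ≠ j) :
    ∃ V ∈ _root_.unitary (H →L[ℂ] H), Commute (T i) V ∧ T j * T i = T i * (T j * V) ∧
      adjoint (T j) * T i = T i * (adjoint (T j) * star V) := by
  have hcomm : ∀ {i j} k, i < j → Commute (T k) (U i j) := fun k h => hT.mul_twist _ _ k h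
  have hcomm' : ∀ {i j} k, i < j → Commute (T k) (star (U i j)) := fun k h =>
    commute_star_of_mem_unitary (hT.unitary _ _ h) (hcomm k h)
  obtain h | h := hij.lt_or_gt
  · refine ⟨star (U i j), Unitary.star_mem (hT.unitary i j h), hcomm' i h, ?_, ?_⟩
    · calc T j * T i = star (U i j) * (U i j * T j * T i) := by
            simp only [← mul_assoc, Unitary.star_mul_self_of_mem (hT.unitary i j h), one_mul]
        _ = star (U i j) * T i * T j := by rw [← hT.mul_mul i j h, mul_assoc]
        _ = T i * (T j * star (U i j)) := by rw [← (hcomm' i h).eq, mul_assoc, (hcomm' j h).eq]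
    · simpa only [← star_eq_adjoint, star_mul, star_star] using
        congrArg star (hT.adjoint_mul i j h)
  · refine ⟨U j i, hT.unitary j i h, hcomm i h, ?_, ?_⟩
    · rw [hT.mul_mul j i h, ← (hcomm i h).eq, mul_assoc, (hcomm j h).eq]
    · have hadj : star (T j) * star (U j i) = star (U j i) * star (T j) := by
        rw [← star_mul, ← star_mul, (hcomm j h).eq]
      rw [hT.adjoint_mul j i h, ← star_eq_adjoint, ← star_eq_adjoint, hadj, ← mul_assoc,
        (hcomm' i h).eq]

/-- A family of scaled near-isometries in which every range `ran (T i)ᵏ` reduces all the other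
operators: the property of a doubly twisted family on which its Wold decomposition rests. -/
structure IsRangeReducingFamily {ι : Type*} (T : ι → H →L[ℂ] H) : Prop where
  isScaledNearIsometry : ∀ i, IsScaledNearIsometry (T i)
  reduces_powRange : ∀ {i j}, i ≠ j → ∀ k, Reduces (powRange (T i) k) (T j)

theorem IsDoublyTwistedNearIsometry.isRangeReducingFamily
    (hT : IsDoublyTwistedNearIsometry T U) : IsRangeReducingFamily T where
  isScaledNearIsometry i := (hT.nearIsometry i).isScaledNearIsometry
  reduces_powRange hij k := by
    obtain ⟨V, hV, hcomm, hmul, hadj⟩ := hT.exists_twist hij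
    exact reduces_powRange_of_mul_twist hmul hcomm hadj (commute_star_of_mem_unitary hV hcomm) k

end Twist

section WoldSpaces

variable {H : Type*} [NormedAddCommGroup H] [InnerProductSpace ℂ H]

/-- The Wold summand `H_A` of a family: the part of the space lying in the core of `T i` for
`i ∉ A` and orthogonal to it for `i ∈ A`. -/
noncomputable def woldSpace {ι : Type*} (T : ι → H →L[ℂ] H) (A : Finset ι) : Submodule ℂ H :=
  (⨅ i ∈ A, (powCore (T i))ᗮ) ⊓ ⨅ (i) (_ : i ∉ A), powCore (T i)

variable {ι : Type*} {T : ι → H →L[ℂ] H} {A B : Finset ι} {i j : ι}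

theorem woldSpace_le_orthogonal_powCore (hi : i ∈ A) : woldSpace T A ≤ (powCore (T i))ᗮ :=
  inf_le_left.trans (iInf₂_le i hi)

theorem woldSpace_le_powCore (hi : i ∉ A) : woldSpace T A ≤ powCore (T i) :=
  inf_le_right.trans (iInf₂_le i hi)

theorem woldSpace_isOrtho (h : A ≠ B) : woldSpace T A ⟂ woldSpace T B := by
  obtain ⟨i, hi⟩ : ∃ i, ¬(i ∈ A ↔ i ∈ B) := by
    by_contra! hall
    exact h (Finset.ext hall)
  by_cases hA : i ∈ A
  · exact ((Submodule.isOrtho_orthogonal_right _).mono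
      (woldSpace_le_powCore fun hB => hi (iff_of_true hA hB))
      (woldSpace_le_orthogonal_powCore hA)).symm
  · have hB : i ∈ B := by tauto
    exact (Submodule.isOrtho_orthogonal_right _).mono (woldSpace_le_powCore hA)
      (woldSpace_le_orthogonal_powCore hB)

namespace IsRangeReducingFamily

variable [CompleteSpace H] (hT : IsRangeReducingFamily T)
include hT

theorem reduces_powLayer (hij : i ≠ j) (k : ℕ) : Reduces (powLayer (T i) k) (T j) :=
  (hT.reduces_powRange hij k).inf (hT.reduces_powRange hij (k + 1)).orthogonal

theorem reduces_powCore (i j : ι) : Reduces (powCore (T i)) (T j) := by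
  obtain rfl | hij := eq_or_ne i j
  · exact (hT.isScaledNearIsometry i).reduces_powCore
  · exact Reduces.iInf (hT.reduces_powRange hij)

theorem isClosed_powCore (i : ι) : IsClosed (powCore (T i) : Set H) :=
  (hT.isScaledNearIsometry i).isClosed_powCore

theorem isClosed_powLayer (i : ι) (k : ℕ) : IsClosed (powLayer (T i) k : Set H) :=
  (hT.isScaledNearIsometry i).isClosed_powLayer k

theorem isClosed_iInf_powCore (A : Finset ι) :
    IsClosed ((⨅ (i) (_ : i ∉ A), powCore (T i) : Submodule ℂ H) : Set H) :=
  isClosed_coe_iInf fun i => isClosed_coe_iInf fun _ => hT.isClosed_powCore i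

theorem isClosed_woldSpace (A : Finset ι) : IsClosed (woldSpace T A : Set H) :=
  (isClosed_coe_iInf fun _ => isClosed_coe_iInf fun _ => Submodule.isClosed_orthogonal _).inter
    (hT.isClosed_iInf_powCore A)

theorem reduces_woldSpace (A : Finset ι) (i : ι) : Reduces (woldSpace T A) (T i) :=
  (Reduces.iInf fun j => Reduces.iInf fun _ => (hT.reduces_powCore j i).orthogonal).inf
    (Reduces.iInf fun j => Reduces.iInf fun _ => hT.reduces_powCore j i)

theorem closure_iSup_woldSpace [Finite ι] : (⨆ A, woldSpace T A).topologicalClosure = ⊤ := by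
  classical
  have := Fintype.ofFinite ι
  have (i : ι) : CompleteSpace (powCore (T i)) := (hT.isClosed_powCore i).completeSpace_coe
  let V (i : ι) (b : Bool) : Submodule ℂ H := if b then (powCore (T i))ᗮ else powCore (T i)
  have (i : ι) (b : Bool) : CompleteSpace (V i b) := by cases b <;> dsimp [V] <;> infer_instance
  have hspan (i : ι) : ⊤ ≤ (⨆ b, V i b).topologicalClosure := by
    refine le_trans (le_of_eq ?_) (Submodule.le_topologicalClosure _)
    rw [iSup_bool_eq, ← Submodule.sup_orthogonal_of_hasOrthogonalProjection (K := powCore (T i)),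
      sup_comm]
    rfl
  have hred (i j : ι) (b c : Bool) : Reduces (V i b) (V j c).starProjection := by
    have hV : Reduces (V j c) (T i) := by
      cases c
      exacts [hT.reduces_powCore j i, (hT.reduces_powCore j i).orthogonal]
    cases b
    exacts [hV.powCore_starProjection, hV.powCore_starProjection.orthogonal]
  refine eq_top_iff.2 ((le_closure_iSup_inf_iInf isClosed_univ hspan
    (fun _ _ => reduces_top) fun i j _ => hred i j).trans
    (Submodule.topologicalClosure_mono (iSup_le fun c => ?_)))
  refine le_iSup_of_le (Finset.univ.filter fun i => c i = true) (inf_le_right.trans (le_inf ?_ ?_))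
  all_goals
    refine le_iInf₂ fun i hi => (iInf_le _ i).trans (le_of_eq ?_)
    simp only [Finset.mem_filter, Finset.mem_univ, true_and] at hi
    simp only [V, hi, if_true, if_false, Bool.false_eq_true]

end IsRangeReducingFamily

end WoldSpaces

section WoldDecomposition

variable {H : Type*} [NormedAddCommGroup H] [InnerProductSpace ℂ H] [CompleteSpace H] {n : ℕ}
  {T : Fin n → H →L[ℂ] H}

theorem IsRangeReducingFamily.isWoldDecomposition_woldSpace (hT : IsRangeReducingFamily T) :
    IsWoldDecomposition T (woldSpace T) where
  orthogonalSum := ⟨hT.isClosed_woldSpace, fun _ _ => woldSpace_isOrtho, hT.closure_iSup_woldSpace⟩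
  reduces := hT.reduces_woldSpace
  shift A i hi := (hT.reduces_woldSpace A i).isShift_restriction (hT.isScaledNearIsometry i)
    (hT.isClosed_woldSpace A) (woldSpace_le_orthogonal_powCore hi)
  invertible A i hi := (hT.reduces_woldSpace A i).isUnit_restriction (hT.isScaledNearIsometry i)
    (hT.isClosed_woldSpace A) (woldSpace_le_powCore hi)

theorem IsWoldDecomposition.eq_woldSpace {𝓗 : Finset (Fin n) → Submodule ℂ H}
    (h : IsWoldDecomposition T 𝓗) : 𝓗 = woldSpace T :=
  h.orthogonalSum.eq_of_le (fun _ _ => woldSpace_isOrtho) fun A => le_inf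
    (le_iInf₂ fun i hi => (h.reduces A i).le_orthogonal_powCore_of_isShift
      (h.orthogonalSum.isClosed A) (h.shift A i hi))
    (le_iInf₂ fun i hi => (h.reduces A i).le_powCore_of_isUnit (h.invertible A i hi))

end WoldDecomposition

section Tuples

variable {H : Type*} [NormedAddCommGroup H] [InnerProductSpace ℂ H] [CompleteSpace H]
  {N : Submodule ℂ H}

theorem imageUnder_list_prod_inf_iInf {ι : Type*} {S : ι → H →L[ℂ] H} {F G : ι → Submodule ℂ H}
    {l : List ι} (hl : l.Nodup) (hS : ∀ i, Function.Injective (S i))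
    (hFG : ∀ i, imageUnder (S i) (F i) = G i) (hF : ∀ i, IsClosed (F i : Set H))
    (hG : ∀ i, IsClosed (G i : Set H)) (hFS : ∀ i j, i ≠ j → Reduces (F i) (S j))
    (hGS : ∀ i j, i ≠ j → Reduces (G i) (S j)) (hN : IsClosed (N : Set H))
    (hNS : ∀ i ∈ l, Reduces N (S i)) :
    imageUnder (l.map S).prod (N ⊓ ⨅ i ∈ l, F i) = N ⊓ ⨅ i ∈ l, G i := by
  induction l generalizing N with
  | nil => simp only [List.not_mem_nil, iInf_false, iInf_top, inf_top_eq, List.map_nil,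
      List.prod_nil, imageUnder_one]
  | cons i l ih =>
    obtain ⟨hil, hl⟩ := List.nodup_cons.1 hl
    have hrest : Reduces (N ⊓ ⨅ j ∈ l, G j) (S i) := (hNS i List.mem_cons_self).inf
      (Reduces.iInf fun j => Reduces.iInf fun hj => hGS j i (ne_of_mem_of_not_mem hj hil))
    have hclosed : IsClosed ((N ⊓ ⨅ j ∈ l, G j : Submodule ℂ H) : Set H) :=
      hN.inter (isClosed_coe_iInf fun j => isClosed_coe_iInf fun _ => hG j)
    simp only [List.mem_cons, iInf_or, iInf_inf_eq, iInf_iInf_eq_left]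
    rw [List.map_cons, List.prod_cons, imageUnder_mul, ← inf_assoc,
      ih hl (hN.inter (hF i)) fun j hj => (hNS j (List.mem_cons_of_mem i hj)).inf
        (hFS i j (ne_of_mem_of_not_mem hj hil).symm)]
    calc imageUnder (S i) (N ⊓ F i ⊓ ⨅ j ∈ l, G j)
        = imageUnder (S i) ((N ⊓ ⨅ j ∈ l, G j) ⊓ F i) := by rw [inf_right_comm]
      _ = N ⊓ (G i ⊓ ⨅ j ∈ l, G j) := by
          rw [hrest.imageUnder_inf hclosed (hS i), hFG, inf_right_comm, inf_assoc]

variable {n : ℕ} {T : Fin n → H →L[ℂ] H} {A : Finset (Fin n)}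

theorem imageUnder_tuplePow_inf_iInf {F : Fin n → ℕ → Submodule ℂ H}
    (hT : ∀ i (k : ℕ), Function.Injective (T i ^ k))
    (hF : ∀ i k, imageUnder (T i ^ k) (F i 0) = F i k)
    (hclosed : ∀ i k, IsClosed (F i k : Set H))
    (hFT : ∀ i j, i ≠ j → ∀ k, Reduces (F i k) (T j)) (hN : IsClosed (N : Set H))
    (hNT : ∀ i ∈ A, Reduces N (T i)) (k : A → ℕ) :
    imageUnder (tuplePow T A k) (N ⊓ ⨅ i ∈ A, F i 0) = N ⊓ ⨅ i : A, F i (k i) := by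
  let S (i : Fin n) : H →L[ℂ] H := if h : i ∈ A then T i ^ k ⟨i, h⟩ else 1
  have hS (i : Fin n) : Function.Injective (S i) := by
    dsimp only [S]
    split_ifs
    exacts [hT i _, Function.injective_id]
  have himage (i : Fin n) :
      imageUnder (S i) (⨅ _ : i ∈ A, F i 0) = ⨅ h : i ∈ A, F i (k ⟨i, h⟩) := by
    by_cases h : i ∈ A
    · simp only [S, h, dif_pos, iInf_pos, hF]
    · simp only [S, h, dif_neg, not_false_eq_true, iInf_false, imageUnder_one]
  have hreduces {M : Submodule ℂ H} {j : Fin n} (h : j ∈ A → Reduces M (T j)) :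
      Reduces M (S j) := by
    dsimp only [S]
    split_ifs with hj
    exacts [(h hj).pow _, reduces_one]
  have hprod := imageUnder_list_prod_inf_iInf (List.nodup_finRange n) hS himage
    (fun i => isClosed_coe_iInf fun _ => hclosed i 0)
    (fun i => isClosed_coe_iInf fun _ => hclosed i _)
    (fun i j hij => hreduces fun _ => Reduces.iInf fun _ => hFT i j hij 0)
    (fun i j hij => hreduces fun _ => Reduces.iInf fun _ => hFT i j hij _)
    hN (fun i _ => hreduces (hNT i))
  simp only [List.mem_finRange, iInf_pos, ← List.ofFn_eq_map] at hprod
  rw [tuplePow, hprod, iInf_subtype]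

namespace IsRangeReducingFamily

variable (hT : IsRangeReducingFamily T)
include hT

theorem iInf_imageUnder_tuplePow (hN : IsClosed (N : Set H)) (hNT : ∀ i ∈ A, Reduces N (T i)) :
    ⨅ l : A → ℕ, imageUnder (tuplePow T A l) N = N ⊓ ⨅ i ∈ A, powCore (T i) := by
  have himage (l : A → ℕ) :
      imageUnder (tuplePow T A l) N = N ⊓ ⨅ i : A, powRange (T i) (l i) := by
    have h := imageUnder_tuplePow_inf_iInf (F := fun i => powRange (T i))
      (fun i => (hT.isScaledNearIsometry i).injective_pow)
      (fun i k => by rw [powRange_zero]; rfl)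
      (fun i => (hT.isScaledNearIsometry i).isClosed_powRange)
      (fun i j hij => hT.reduces_powRange hij) hN hNT l
    simpa only [powRange_zero, iInf_top, inf_top_eq] using h
  calc ⨅ l : A → ℕ, imageUnder (tuplePow T A l) N
      = N ⊓ ⨅ (i : A) (l : A → ℕ), powRange (T i) (l i) := by
        rw [iInf_comm, inf_iInf]
        exact iInf_congr himage
    _ = N ⊓ ⨅ i : A, powCore (T i) := by
        congr 1
        exact iInf_congr fun i =>
          (Function.surjective_eval (β := fun _ : A => ℕ) i).iInf_comp (powRange (T i))
    _ = N ⊓ ⨅ i ∈ A, powCore (T i) := by rw [iInf_subtype]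

theorem wanderingCore_eq (A : Finset (Fin n)) :
    wanderingCore T A = (⨅ (i) (_ : i ∉ A), powCore (T i)) ⊓ ⨅ i ∈ A, powLayer (T i) 0 := by
  have hwandering : wanderingSpace T A = ⨅ i ∈ A, powLayer (T i) 0 := by
    simp only [wanderingSpace, powLayer_zero_eq_ker_adjoint]
  have hclosed : IsClosed ((⨅ i ∈ A, powLayer (T i) 0 : Submodule ℂ H) : Set H) :=
    isClosed_coe_iInf fun i => isClosed_coe_iInf fun _ => hT.isClosed_powLayer i 0
  have hreduces : ∀ j ∈ Aᶜ, Reduces (⨅ i ∈ A, powLayer (T i) 0) (T j) := fun j hj =>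
    Reduces.iInf fun i => Reduces.iInf fun hi =>
      hT.reduces_powLayer (ne_of_mem_of_not_mem hi (Finset.mem_compl.1 hj)) 0
  rw [wanderingCore, hwandering, hT.iInf_imageUnder_tuplePow hclosed hreduces, inf_comm]
  simp only [Finset.mem_compl]

theorem imageUnder_tuplePow_wanderingCore (A : Finset (Fin n)) (k : A → ℕ) :
    imageUnder (tuplePow T A k) (wanderingCore T A) =
      (⨅ (i) (_ : i ∉ A), powCore (T i)) ⊓ ⨅ i : A, powLayer (T i) (k i) := by
  rw [hT.wanderingCore_eq]
  exact imageUnder_tuplePow_inf_iInf (F := fun i => powLayer (T i))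
    (fun i => (hT.isScaledNearIsometry i).injective_pow)
    (fun i => (hT.isScaledNearIsometry i).imageUnder_pow_powLayer_zero) hT.isClosed_powLayer
    (fun i j hij => hT.reduces_powLayer hij) (hT.isClosed_iInf_powCore A)
    (fun i _ => Reduces.iInf fun j => Reduces.iInf fun _ => hT.reduces_powCore j i) k

theorem woldSpace_empty_eq :
    woldSpace T ∅ = ⨅ k : ↥(Finset.univ : Finset (Fin n)) → ℕ,
      imageUnder (tuplePow T Finset.univ k) ⊤ := by
  rw [hT.iInf_imageUnder_tuplePow isClosed_univ fun _ _ => reduces_top]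
  simp only [woldSpace, Finset.notMem_empty, Finset.mem_univ, iInf_false, iInf_top, iInf_pos,
    not_false_eq_true]

theorem woldSpace_le_closure_iSup (A : Finset (Fin n)) :
    woldSpace T A ≤
      (⨆ k : A → ℕ, woldSpace T A ⊓ ⨅ i : A, powLayer (T i) (k i)).topologicalClosure := by
  have : CompleteSpace (woldSpace T A) := (hT.isClosed_woldSpace A).completeSpace_coe
  have (i : A) (k : ℕ) : CompleteSpace (powLayer (T i) k) :=
    (hT.isClosed_powLayer i k).completeSpace_coe
  refine le_closure_iSup_inf_iInf (V := fun i : A => powLayer (T i)) (hT.isClosed_woldSpace A)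
    (fun i => ?_) (fun i k => ?_) (fun i j hij k l => ?_)
  · exact (woldSpace_le_orthogonal_powCore i.2).trans
      (hT.isScaledNearIsometry i).orthogonal_powCore_le
  · exact ((hT.reduces_woldSpace A i).powLayer_starProjection k).starProjection_symm
  · exact (hT.reduces_powLayer (Subtype.coe_ne_coe.2 hij.symm) l).powLayer_starProjection k

theorem isOrthogonalSum_woldSpace (A : Finset (Fin n)) :
    IsOrthogonalSum (woldSpace T A)
      (fun k : A → ℕ => imageUnder (tuplePow T A k) (wanderingCore T A)) := by
  simp only [hT.imageUnder_tuplePow_wanderingCore]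
  refine ⟨fun k => ?_, fun k l hkl => ?_, le_antisymm ?_ ?_⟩
  · exact (hT.isClosed_iInf_powCore A).inter
      (isClosed_coe_iInf fun i => hT.isClosed_powLayer i (k i))
  · obtain ⟨i, hi⟩ := Function.ne_iff.1 hkl
    exact (powLayer_isOrtho (T i) hi).mono (inf_le_right.trans (iInf_le _ i))
      (inf_le_right.trans (iInf_le _ i))
  · refine Submodule.topologicalClosure_minimal _ (iSup_le fun k => ?_) (hT.isClosed_woldSpace A)
    refine le_inf (le_iInf₂ fun i hi => ?_) inf_le_left
    exact (inf_le_right.trans (iInf_le (fun i : A => powLayer (T i) (k i)) ⟨i, hi⟩)).trans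
      (powLayer_le_orthogonal_powCore (T i) _)
  · exact (hT.woldSpace_le_closure_iSup A).trans (Submodule.topologicalClosure_mono
      (iSup_mono fun k => inf_le_inf_right _ inf_le_right))

end IsRangeReducingFamily

end Tuples

theorem theorem1_general {H : Type*} [NormedAddCommGroup H] [InnerProductSpace ℂ H]
    [CompleteSpace H] {n : ℕ} {T : Fin n → H →L[ℂ] H} (hT : IsRangeReducingFamily T) :
    (∃! 𝓗 : Finset (Fin n) → Submodule ℂ H, IsWoldDecomposition T 𝓗) ∧
    ∀ 𝓗 : Finset (Fin n) → Submodule ℂ H, IsWoldDecomposition T 𝓗 →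
      (∀ A : Finset (Fin n),
        IsOrthogonalSum (𝓗 A) (fun k : A → ℕ => imageUnder (tuplePow T A k) (wanderingCore T A))) ∧
      𝓗 ∅ = ⨅ k : ↥(Finset.univ : Finset (Fin n)) → ℕ,
        imageUnder (tuplePow T Finset.univ k) ⊤ := by
  refine ⟨⟨woldSpace T, hT.isWoldDecomposition_woldSpace, fun 𝓗 h => h.eq_woldSpace⟩,
    fun 𝓗 h => ?_⟩
  rw [h.eq_woldSpace]
  exact ⟨hT.isOrthogonalSum_woldSpace, hT.woldSpace_empty_eq⟩

theorem theorem1 {H : Type*} [NormedAddCommGroup H] [InnerProductSpace ℂ H] [CompleteSpace H]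
    {n : ℕ} (hn : 2 ≤ n) (T : Fin n → H →L[ℂ] H) (U : Fin n → Fin n → H →L[ℂ] H)
    (hT : IsDoublyTwistedNearIsometry T U) :
    (∃! 𝓗 : Finset (Fin n) → Submodule ℂ H, IsWoldDecomposition T 𝓗) ∧
    ∀ 𝓗 : Finset (Fin n) → Submodule ℂ H, IsWoldDecomposition T 𝓗 →
      (∀ A : Finset (Fin n),
        IsOrthogonalSum (𝓗 A) (fun k : A → ℕ => imageUnder (tuplePow T A k) (wanderingCore T A))) ∧
      𝓗 ∅ = ⨅ k : ↥(Finset.univ : Finset (Fin n)) → ℕ,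
        imageUnder (tuplePow T Finset.univ k) ⊤ :=
  theorem1_general hT.isRangeReducingFamily
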